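/- Let $\mathcal{H}$ be a separable complex Hilbert space, let $\mathrm{U}(\mathcal{H})$ be its unitary group with the strong operator topology, and let $N \ge 0$. Let $H_0$ be a (possibly unbounded) selfadjoint operator on $\mathcal{H}$ with pure point spectrum, i.e. $\mathcal{H}$ has an orthonormal basis consisting of eigenvectors of $H_0$ (the eigenvalues need not be isolated), and let $H_1, \dots, H_N$ be bounded selfadjoint operators on $\mathcal{H}$. For $\mathbf{y} = (y_1,\dots,y_N) \in \mathbb{R}^N$ let $H(\mathbf{y}) = H_0 + \sum_{j=1}^N y_j H_j$, which is selfadjoint on the domain of $H_0$. For a selfadjoint operator $A$ let $t \mapsto \exp(itA)$ denote the strongly continuous one-parameter unitary group with generator $iA$. Let $\mathcal{R}_0$ be the smallest subsemigroup of $\mathrm{U}(\mathcal{H})$ containing all $\exp(i\tau H(\mathbf{y}))$ with $\tau > 0$ and $\mathbf{y} \in \mathbb{R}^N$, and let the strongly reachable set $\mathcal{R}$ be the closure of $\mathcal{R}_0$ in $\mathrm{U}(\mathcal{H})$ in the strong topology. Let the restricted dynamical group $\hat{\mathcal{G}}$ be the smallest strongly closed subgroup of $\mathrm{U}(\mathcal{H})$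 containing all $\exp(itH_j)$ with $t \in \mathbb{R}$ and $j = 0, \dots, N$. Then $\mathcal{R} = \hat{\mathcal{G}}$. -/

import Mathlib

namespace QuantumControl

open scoped Topology

section

variable {E : Type*} [NormedAddCommGroup E] [InnerProductSpace ℂ E] [CompleteSpace E]

/-- The strong operator topology on the unitary group `U(E)`: the topology of pointwise
convergence, i.e. the coarsest topology for which all maps `U ↦ U x` with `x : E` are
continuous. -/
@[reducible]
def strongTopology (E : Type*) [NormedAddCommGroup E] [InnerProductSpace ℂ E]
    [CompleteSpace E] : TopologicalSpace (unitary (E →L[ℂ] E)) :=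
  TopologicalSpace.induced (fun U (x : E) => (U : E →L[ℂ] E) x) Pi.topologicalSpace

/-- `U` is the strongly continuous one-parameter unitary group `t ↦ exp(i t A)` of the
(possibly unbounded) operator `A`: the infinitesimal generator of `U` is exactly `i A`, so that
`x` lies in the domain of `A` with `A x = y` if and only if `t ↦ U t x` is differentiable
at `0` with derivative `i y`. (By Stone's theorem, every selfadjoint `A` has exactly one such
group.) -/
structure IsUnitaryGroupOf (A : E →ₗ.[ℂ] E) (U : ℝ → unitary (E →L[ℂ] E)) : Prop where
  map_add : ∀ s t : ℝ, U (s + t) = U s * U t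
  continuous : ∀ x : E, Continuous fun t : ℝ => (U t : E →L[ℂ] E) x
  generator : ∀ x y : E, (x, y) ∈ A.graph ↔
    HasDerivAt (fun t : ℝ => (U t : E →L[ℂ] E) x) (Complex.I • y) 0

/-- `IsExp A t V` says that `V = exp(i t A)`. -/
def IsExp (A : E →ₗ.[ℂ] E) (t : ℝ) (V : unitary (E →L[ℂ] E)) : Prop :=
  ∃ U : ℝ → unitary (E →L[ℂ] E), IsUnitaryGroupOf A U ∧ V = U t

/-- A (selfadjoint) operator has pure point spectrum if its eigenvectors span a dense subspace;
for a selfadjoint operator this means that there is an orthonormal basis of eigenvectors. -/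
def HasPurePointSpectrum (A : E →ₗ.[ℂ] E) : Prop :=
  Dense (Submodule.span ℂ {x : E | x ≠ 0 ∧ ∃ c : ℂ, (x, c • x) ∈ A.graph} : Set E)

/-- A bounded operator, viewed as a partially defined operator whose domain is everything. -/
def ofBounded (B : E →L[ℂ] E) : E →ₗ.[ℂ] E :=
  (B : E →ₗ[ℂ] E).toPMap ⊤

variable {N : ℕ}

/-- The Hamiltonian `H(y) = H₀ + ∑ j, y j • H j`, with the same domain as the drift `H₀`. -/
noncomputable def hamiltonian (H₀ : E →ₗ.[ℂ] E) (Hc : Fin N → E →L[ℂ] E) (y : Fin N → ℝ) :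
    E →ₗ.[ℂ] E :=
  ((∑ j, (y j : ℂ) • Hc j : E →L[ℂ] E) : E →ₗ[ℂ] E) +ᵥ H₀

/-- The algebraically reachable set: the smallest subsemigroup of the unitary group
containing all `exp(i τ H(y))` with `τ > 0` and `y ∈ ℝ^N`. -/
noncomputable def algebraicallyReachableSet (H₀ : E →ₗ.[ℂ] E) (Hc : Fin N → E →L[ℂ] E) :
    Subsemigroup (unitary (E →L[ℂ] E)) :=
  Subsemigroup.closure
    {V | ∃ (τ : ℝ) (y : Fin N → ℝ), 0 < τ ∧ IsExp (hamiltonian H₀ Hc y) τ V}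

/-- The strongly reachable set: the strong closure of the algebraically reachable set. -/
def stronglyReachableSet (H₀ : E →ₗ.[ℂ] E) (Hc : Fin N → E →L[ℂ] E) :
    Set (unitary (E →L[ℂ] E)) :=
  closure[strongTopology E] (algebraicallyReachableSet H₀ Hc : Set (unitary (E →L[ℂ] E)))

/-- The restricted dynamical group: the smallest strongly closed subgroup of the unitary group
containing all `exp(i t H₀)` and all `exp(i t H j)` with `t ∈ ℝ`. -/
noncomputable def restrictedDynamicalGroup (H₀ : E →ₗ.[ℂ] E) (Hc : Fin N → E →L[ℂ] E) :
    Subgroup (unitary (E →L[ℂ] E)) :=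
  sInf {K | IsClosed[strongTopology E] (K : Set (unitary (E →L[ℂ] E))) ∧
    (∀ (t : ℝ) (V : unitary (E →L[ℂ] E)), IsExp H₀ t V → V ∈ K) ∧
    (∀ (j : Fin N) (t : ℝ) (V : unitary (E →L[ℂ] E)), IsExp (ofBounded (Hc j)) t V → V ∈ K)}

end

end QuantumControl

namespace QuantumControl

open scoped Topology InnerProductSpace
open Filter

/-! ### Unitaries acting on vectors, and uniqueness of one-parameter groups. -/

section

variable {E : Type*} [NormedAddCommGroup E] [InnerProductSpace ℂ E] [CompleteSpace E]

/-! Reachable unitaries lie in the group because Trotter's formula, applied one control at a time,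
writes exp(iτH(y)) as a strong limit of products of drift and control exponentials
(`mem_of_isExp_hamiltonian`).

The reverse inclusion needs the drift at negative times. The eigenphases of exp(iτH₀) form a point
of a product of circles; this group is compact, so the powers of the point cluster at 1. Hence
exp(i(nτ+t)H₀) tends strongly to exp(itH₀) along some filter finer than n → ∞, even for t < 0
(`exists_recurrence`). Once the drift can be undone, (exp(-iH₀/n) exp(i(H₀+tH_j)/n))^n → exp(itH_j)
isolates each control (`tendsto_interaction_pow`).

Both product formulas are cases of `tendsto_pow_of_isLittleO`. Since the perturbations are bounded,
the one-step error is O(h) in norm, so it is enough to check that it is o(h) on a dense domain.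

All this requires the exponentials to exist. The drift group is built diagonally on an eigenbasis
(`exists_isUnitaryGroupOf_diagonal`), the perturbed ones by a Dyson series in the interaction
picture (`exists_perturbed`). Uniqueness follows from conservation of the norm. -/

lemma norm_unitary_apply (V : unitary (E →L[ℂ] E)) (x : E) : ‖(V : E →L[ℂ] E) x‖ = ‖x‖ :=
  ContinuousLinearMap.norm_map_of_mem_unitary V.2 x

@[simp]
lemma unitary_mul_apply (V W : unitary (E →L[ℂ] E)) (x : E) :
    ((V * W : unitary (E →L[ℂ] E)) : E →L[ℂ] E) x = (V : E →L[ℂ] E) ((W : E →L[ℂ] E) x) := rfl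

@[simp]
lemma unitary_one_apply (x : E) : ((1 : unitary (E →L[ℂ] E)) : E →L[ℂ] E) x = x := rfl

lemma unitary_ext {V W : unitary (E →L[ℂ] E)}
    (h : ∀ x, (V : E →L[ℂ] E) x = (W : E →L[ℂ] E) x) : V = W :=
  Subtype.ext (ContinuousLinearMap.ext h)

@[simp]
lemma unitary_inv_apply_self (V : unitary (E →L[ℂ] E)) (x : E) :
    ((V⁻¹ : unitary (E →L[ℂ] E)) : E →L[ℂ] E) ((V : E →L[ℂ] E) x) = x := by
  rw [← unitary_mul_apply, inv_mul_cancel, unitary_one_apply]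

@[simp]
lemma unitary_apply_inv_self (V : unitary (E →L[ℂ] E)) (x : E) :
    (V : E →L[ℂ] E) (((V⁻¹ : unitary (E →L[ℂ] E)) : E →L[ℂ] E) x) = x := by
  rw [← unitary_mul_apply, mul_inv_cancel, unitary_one_apply]

lemma inner_unitary_apply (V : unitary (E →L[ℂ] E)) (x y : E) :
    ⟪(V : E →L[ℂ] E) x, (V : E →L[ℂ] E) y⟫_ℂ = ⟪x, y⟫_ℂ :=
  ContinuousLinearMap.inner_map_map_of_mem_unitary V.2 x y

/-- A product rule for strongly continuous unitary families applied to moving vectors. -/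
lemma HasDerivAt.unitary_apply {G : ℝ → unitary (E →L[ℂ] E)} {f : ℝ → E} {f' D : E} {t : ℝ}
    (hG : ∀ x, ContinuousAt (fun s => (G s : E →L[ℂ] E) x) t)
    (hD : HasDerivAt (fun s => (G s : E →L[ℂ] E) (f t)) D t) (hf : HasDerivAt f f' t) :
    HasDerivAt (fun s => (G s : E →L[ℂ] E) (f s)) (D + (G t : E →L[ℂ] E) f') t := by
  -- Isometry of `G s` controls the remainder of `f`, and strong continuity controls (s - t)(G s f'
  -- - G t f'); no norm continuity is needed.
  have key : HasDerivAt (fun s => (G s : E →L[ℂ] E) (f s - f t)) ((G t : E →L[ℂ] E) f') t := by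
    rw [hasDerivAt_iff_isLittleO] at hf ⊢
    have h1 : (fun s => (G s : E →L[ℂ] E) (f s - f t - (s - t) • f')) =o[𝓝 t]
        fun s => s - t := by
      refine (Asymptotics.IsBigO.of_bound 1 ?_).trans_isLittleO hf
      exact Eventually.of_forall fun s => by rw [norm_unitary_apply, one_mul]
    have h2 : (fun s => (s - t) • ((G s : E →L[ℂ] E) f' - (G t : E →L[ℂ] E) f')) =o[𝓝 t]
        fun s => s - t := by
      have h3 : (fun s => (G s : E →L[ℂ] E) f' - (G t : E →L[ℂ] E) f') =o[𝓝 t]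
          fun _ => (1 : ℝ) := by
        rw [Asymptotics.isLittleO_one_iff]
        simpa using (hG f').sub_const ((G t : E →L[ℂ] E) f')
      simpa using (Asymptotics.isBigO_refl (fun s => s - t) (𝓝 t)).smul_isLittleO h3
    refine (h1.add h2).congr_left fun s => ?_
    have : (G s : E →L[ℂ] E) ((s - t) • f') = (s - t) • (G s : E →L[ℂ] E) f' :=
      ContinuousLinearMap.map_smul_of_tower _ _ _
    rw [map_sub _ (f s - f t), this, sub_self, map_zero, smul_sub]
    abel
  refine (hD.add key).congr_of_eventuallyEq (Eventually.of_forall fun s => ?_)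
  simp

namespace IsUnitaryGroupOf

variable {A : E →ₗ.[ℂ] E} {U : ℝ → unitary (E →L[ℂ] E)}

lemma map_zero (hU : IsUnitaryGroupOf A U) : U 0 = 1 := by
  have h := hU.map_add 0 0
  rw [add_zero] at h
  exact left_eq_mul.mp h

lemma map_neg (hU : IsUnitaryGroupOf A U) (t : ℝ) : U (-t) = (U t)⁻¹ := by
  rw [eq_inv_iff_mul_eq_one, ← hU.map_add, neg_add_cancel, hU.map_zero]

lemma add_apply (hU : IsUnitaryGroupOf A U) (s t : ℝ) (x : E) :
    (U (s + t) : E →L[ℂ] E) x = (U s : E →L[ℂ] E) ((U t : E →L[ℂ] E) x) := by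
  rw [hU.map_add, unitary_mul_apply]

/-- Orbits of vectors in the domain stay in the domain. -/
lemma apply_mem_graph (hU : IsUnitaryGroupOf A U) {x y : E} (h : (x, y) ∈ A.graph) (t : ℝ) :
    ((U t : E →L[ℂ] E) x, (U t : E →L[ℂ] E) y) ∈ A.graph := by
  rw [hU.generator] at h ⊢
  have h1 := ((U t : E →L[ℂ] E).restrictScalars ℝ).hasFDerivAt.comp_hasDerivAt (0 : ℝ) h
  refine (h1.congr_of_eventuallyEq (Eventually.of_forall fun s => ?_)).congr_deriv ?_
  · simp only [Function.comp, ContinuousLinearMap.coe_restrictScalars']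
    rw [← hU.add_apply, ← hU.add_apply, add_comm]
  · simp

lemma hasDerivAt (hU : IsUnitaryGroupOf A U) {x y : E} (h : (x, y) ∈ A.graph) (t : ℝ) :
    HasDerivAt (fun s => (U s : E →L[ℂ] E) x) (Complex.I • (U t : E →L[ℂ] E) y) t := by
  have h1 := (hU.generator _ _).mp (hU.apply_mem_graph h t)
  have h2 : HasDerivAt (fun s : ℝ => s - t) 1 t := (hasDerivAt_id t).sub_const t
  have h3 := HasDerivAt.scomp_of_eq t h1 h2 (sub_self t).symm
  rw [one_smul] at h3
  refine h3.congr_of_eventuallyEq (Eventually.of_forall fun s => ?_)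
  simp only [Function.comp]
  rw [← hU.add_apply, sub_add_cancel]

lemma hasDerivAt_neg (hU : IsUnitaryGroupOf A U) {x y : E} (h : (x, y) ∈ A.graph) (t : ℝ) :
    HasDerivAt (fun s => (U (-s) : E →L[ℂ] E) x) (-(Complex.I • (U (-t) : E →L[ℂ] E) y)) t := by
  have h3 := HasDerivAt.scomp t (hU.hasDerivAt h (-t)) (_root_.hasDerivAt_neg t)
  rw [neg_one_smul] at h3
  exact h3

end IsUnitaryGroupOf

/-- The derivative of ‖w‖² is 2 Re⟪w, w'⟫. For a difference of two solutions this yields uniqueness,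
for a single solution isometry, without a Gronwall estimate. -/
lemma norm_eq_of_hasDerivAt_of_re_inner_eq_zero
    {F : Type*} [NormedAddCommGroup F] [InnerProductSpace ℂ F]
    {w v : ℝ → F}
    (hw : ∀ t, HasDerivAt w (v t) t) (h : ∀ t, (⟪w t, v t⟫_ℂ).re = 0) (s t : ℝ) :
    ‖w s‖ = ‖w t‖ := by
  have h1 : ∀ t, HasDerivAt (fun s => ⟪w s, w s⟫_ℂ) 0 t := fun t => by
    refine ((hw t).inner ℂ (hw t)).congr_deriv ?_
    rw [← inner_conj_symm (v t), RCLike.add_conj]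
    simp [h t]
  have h2 := is_const_of_deriv_eq_zero (fun t => (h1 t).differentiableAt)
    (fun t => (h1 t).deriv) s t
  rw [inner_self_eq_norm_sq_to_K, inner_self_eq_norm_sq_to_K] at h2
  have h3 : ‖w s‖ ^ 2 = ‖w t‖ ^ 2 := by exact_mod_cast h2
  exact (pow_left_inj₀ (norm_nonneg _) (norm_nonneg _) two_ne_zero).mp h3

lemma re_inner_eq_zero_of_norm_const
    {F : Type*} [NormedAddCommGroup F] [InnerProductSpace ℂ F]
    {w : ℝ → F} {v : F} {t : ℝ}
    (hw : HasDerivAt w v t) (h : ∀ s, ‖w s‖ = ‖w t‖) : (⟪w t, v⟫_ℂ).re = 0 := by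
  have h1 := hw.inner ℂ hw
  have h2 : (fun s => ⟪w s, w s⟫_ℂ) = fun _ => ⟪w t, w t⟫_ℂ := by
    funext s
    rw [inner_self_eq_norm_sq_to_K, inner_self_eq_norm_sq_to_K, h s]
  rw [h2] at h1
  have h3 := h1.unique (hasDerivAt_const t _)
  rw [← inner_conj_symm v, RCLike.add_conj] at h3
  simpa using h3

namespace IsUnitaryGroupOf

variable {A : E →ₗ.[ℂ] E} {U U' : ℝ → unitary (E →L[ℂ] E)}

lemma re_inner_generator (hU : IsUnitaryGroupOf A U) {x y : E} (h : (x, y) ∈ A.graph) :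
    (⟪x, Complex.I • y⟫_ℂ).re = 0 := by
  have h1 := re_inner_eq_zero_of_norm_const ((hU.generator _ _).mp h)
    (fun s => by rw [norm_unitary_apply, norm_unitary_apply])
  simpa [hU.map_zero] using h1

/-- A densely defined operator generates at most one unitary group. -/
lemma unique (hU : IsUnitaryGroupOf A U) (hU' : IsUnitaryGroupOf A U')
    (hA : Dense (A.domain : Set E)) : U = U' := by
  funext t
  have key : ∀ x ∈ (A.domain : Set E), (U t : E →L[ℂ] E) x = (U' t : E →L[ℂ] E) x := by
    intro x hx
    have hg := A.mem_graph ⟨x, hx⟩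
    set y := A ⟨x, hx⟩
    have h1 := norm_eq_of_hasDerivAt_of_re_inner_eq_zero
      (fun s => (hU.hasDerivAt hg s).sub (hU'.hasDerivAt hg s)) (fun s => by
        rw [← smul_sub]
        exact hU.re_inner_generator
          (A.graph.sub_mem (hU.apply_mem_graph hg s) (hU'.apply_mem_graph hg s))) t 0
    simp only [Pi.sub_apply, hU.map_zero, hU'.map_zero, sub_self, norm_zero, norm_eq_zero] at h1
    exact sub_eq_zero.mp h1
  refine Subtype.ext (ContinuousLinearMap.ext fun x => ?_)
  exact congrFun (Continuous.ext_on hA (U t : E →L[ℂ] E).continuous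
    (U' t : E →L[ℂ] E).continuous key) x

end IsUnitaryGroupOf

end

/-! ### Bounded time-dependent linear equations via the Dyson series. -/

section LinearEvolution

variable {F : Type*} [NormedAddCommGroup F] [NormedSpace ℂ F]

/-- A bounded strongly continuous operator family maps continuous paths to continuous paths. -/
lemma continuous_strong_apply {X : Type*} [TopologicalSpace X] {G : X → F →L[ℂ] F} {f : X → F}
    {C : ℝ} (hG : ∀ x, Continuous fun s => G s x) (hC : ∀ s, ‖G s‖ ≤ C) (hf : Continuous f) :
    Continuous fun s => G s (f s) := by
  rw [continuous_iff_continuousAt]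
  intro t
  have h1 : Tendsto (fun s => G s (f s - f t)) (𝓝 t) (𝓝 0) := by
    refine squeeze_zero_norm (a := fun s => C * ‖f s - f t‖)
      (fun s => (G s).le_of_opNorm_le (hC s) _) ?_
    have : Continuous fun s => C * ‖f s - f t‖ := by fun_prop
    simpa using this.tendsto t
  have h2 := h1.add ((hG (f t)).tendsto t)
  rw [zero_add] at h2
  exact h2.congr fun s => by simp

/-- The terms of the Dyson series of the evolution equation `w' = G w`, `w 0 = x`. -/
noncomputable def dysonTerm (G : ℝ → F →L[ℂ] F) (x : F) : ℕ → ℝ → F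
  | 0 => fun _ => x
  | n + 1 => fun t => ∫ s in (0 : ℝ)..t, G s (dysonTerm G x n s)

variable {G : ℝ → F →L[ℂ] F} {C : ℝ}

/-- Each integration contributes a factor C|t|/(n+1); the unordered interval treats both signs of t
at once. -/
lemma norm_dysonTerm_le (hC : ∀ s, ‖G s‖ ≤ C) (x : F) (n : ℕ) (t : ℝ) :
    ‖dysonTerm G x n t‖ ≤ (C * |t|) ^ n / n.factorial * ‖x‖ := by
  induction n generalizing t with
  | zero => simp [dysonTerm]
  | succ n ih =>
    have hint : ‖dysonTerm G x (n + 1) t‖ ≤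
        ∫ s in Set.uIoc 0 t, C ^ (n + 1) / n.factorial * ‖x‖ * |s - 0| ^ n := by
      rw [dysonTerm, intervalIntegral.norm_intervalIntegral_eq]
      refine MeasureTheory.norm_integral_le_of_norm_le
        (Continuous.integrableOn_uIoc (by fun_prop)) (Eventually.of_forall fun s => ?_)
      refine ((G s).le_of_opNorm_le_of_le (hC s) (ih s)).trans_eq ?_
      rw [sub_zero, mul_pow, pow_succ]
      ring
    refine hint.trans_eq ?_
    rw [MeasureTheory.integral_const_mul, integral_pow_abs_sub_uIoc, sub_zero,
      Nat.factorial_succ, mul_pow]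
    push_cast
    field_simp

variable [CompleteSpace F]

lemma hasDerivAt_dysonTerm_succ_of_continuous (hG : ∀ x, Continuous fun s => G s x)
    (hC : ∀ s, ‖G s‖ ≤ C) (x : F) {n : ℕ} (hn : Continuous (dysonTerm G x n)) (t : ℝ) :
    HasDerivAt (dysonTerm G x (n + 1)) (G t (dysonTerm G x n t)) t :=
  (continuous_strong_apply hG hC hn).integral_hasStrictDerivAt 0 t |>.hasDerivAt

lemma continuous_dysonTerm (hG : ∀ x, Continuous fun s => G s x)
    (hC : ∀ s, ‖G s‖ ≤ C) (x : F) (n : ℕ) : Continuous (dysonTerm G x n) := by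
  induction n with
  | zero => exact continuous_const
  | succ n ih =>
    exact continuous_iff_continuousAt.mpr fun t =>
      (hasDerivAt_dysonTerm_succ_of_continuous hG hC x ih t).continuousAt

lemma hasDerivAt_dysonTerm_succ (hG : ∀ x, Continuous fun s => G s x)
    (hC : ∀ s, ‖G s‖ ≤ C) (x : F) (n : ℕ) (t : ℝ) :
    HasDerivAt (dysonTerm G x (n + 1)) (G t (dysonTerm G x n t)) t :=
  hasDerivAt_dysonTerm_succ_of_continuous hG hC x (continuous_dysonTerm hG hC x n) t

/-- Evolution equations with bounded strongly continuous coefficients have global solutions. -/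
theorem exists_hasDerivAt_linear (hG : ∀ x, Continuous fun s => G s x)
    (hC : ∀ s, ‖G s‖ ≤ C) (x : F) :
    ∃ w : ℝ → F, w 0 = x ∧ ∀ t, HasDerivAt w (G t (w t)) t := by
  have hC0 : 0 ≤ C := (norm_nonneg _).trans (hC 0)
  have hsum : ∀ t, Summable fun n => dysonTerm G x n t := fun t =>
    Summable.of_norm_bounded ((Real.summable_pow_div_factorial (C * |t|)).mul_right ‖x‖)
      fun n => norm_dysonTerm_le hC x n t
  have hsum' : ∀ t, Summable fun n => dysonTerm G x (n + 1) t := fun t =>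
    (summable_nat_add_iff 1).mpr (hsum t)
  have hdec : ∀ t, ∑' n, dysonTerm G x n t = x + ∑' n, dysonTerm G x (n + 1) t := fun t => by
    rw [(hsum t).tsum_eq_zero_add]
    rfl
  -- With the constant zeroth term split off, the termwise derivative of the rest is `G t` applied
  -- to the full series.
  refine ⟨fun t => x + ∑' n, dysonTerm G x (n + 1) t, ?_, fun t => ?_⟩
  · simp [dysonTerm]
  -- The bounds on the derivatives are uniform only on bounded time sets, so differentiation takes
  -- place in a ball containing t.
  · have hball : t ∈ Metric.ball (0 : ℝ) (|t| + 1) := by simp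
    have h := hasDerivAt_tsum_of_isPreconnected (t := Metric.ball (0 : ℝ) (|t| + 1))
      (g := fun n => dysonTerm G x (n + 1)) (g' := fun n y => G y (dysonTerm G x n y))
      (y₀ := t) (y := t) (u := fun n => C * ((C * (|t| + 1)) ^ n / n.factorial * ‖x‖))
      (((Real.summable_pow_div_factorial (C * (|t| + 1))).mul_right ‖x‖).mul_left C)
      Metric.isOpen_ball (convex_ball (0 : ℝ) (|t| + 1)).isPreconnected
      (fun n y _ => hasDerivAt_dysonTerm_succ hG hC x n y)
      (fun n y hy => by
        refine (G y).le_of_opNorm_le_of_le (hC y) ((norm_dysonTerm_le hC x n y).trans ?_)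
        have : |y| ≤ |t| + 1 := by
          rw [Metric.mem_ball, dist_zero_right, Real.norm_eq_abs] at hy
          exact hy.le
        gcongr) hball (hsum' t) hball
    refine (h.const_add x).congr_deriv ?_
    rw [← (G t).map_tsum (hsum t), hdec]

end LinearEvolution

/-! ### Skew-adjoint coefficients: uniqueness and isometric propagators. -/

section SkewEvolution

variable {E : Type*} [NormedAddCommGroup E] [InnerProductSpace ℂ E]
  {G : ℝ → E →L[ℂ] E} {C : ℝ}

lemma evolution_unique (hskew : ∀ t x, (⟪x, G t x⟫_ℂ).re = 0) {w v : ℝ → E}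
    (hw : ∀ t, HasDerivAt w (G t (w t)) t) (hv : ∀ t, HasDerivAt v (G t (v t)) t)
    (h0 : w 0 = v 0) (t : ℝ) : w t = v t := by
  have h := norm_eq_of_hasDerivAt_of_re_inner_eq_zero (fun s => (hw s).sub (hv s))
    (fun s => by rw [← map_sub]; exact hskew s _) t 0
  simp only [Pi.sub_apply, h0, sub_self, norm_zero, norm_eq_zero] at h
  exact sub_eq_zero.mp h

variable [CompleteSpace E]

/-- The isometric propagator of a skew-adjoint bounded strongly continuous family. -/
theorem exists_propagator (hG : ∀ x, Continuous fun s => G s x) (hC : ∀ s, ‖G s‖ ≤ C)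
    (hskew : ∀ t x, (⟪x, G t x⟫_ℂ).re = 0) :
    ∃ W : ℝ → E →ₗᵢ[ℂ] E, (∀ x, W 0 x = x) ∧
      ∀ x t, HasDerivAt (fun s => W s x) (G t (W t x)) t := by
  choose w hw0 hw using exists_hasDerivAt_linear hG hC
  refine ⟨fun t =>
    { toFun := fun x => w x t
      map_add' := fun x y => ?_
      map_smul' := fun c x => ?_
      norm_map' := fun x => ?_ }, hw0, hw⟩
  · refine evolution_unique hskew (hw (x + y)) (v := fun t => w x t + w y t) (fun s => ?_) ?_ t
    · rw [map_add]
      exact (hw x s).add (hw y s)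
    · simp [hw0]
  · refine evolution_unique hskew (hw (c • x)) (v := fun t => c • w x t) (fun s => ?_) ?_ t
    · rw [map_smul]
      exact (hw x s).const_smul c
    · simp [hw0]
  · change ‖w x t‖ = ‖x‖
    rw [norm_eq_of_hasDerivAt_of_re_inner_eq_zero (hw x) (fun s => hskew s _) t 0, hw0]

end SkewEvolution

/-! ### Bounded perturbations of a generator. -/

section Perturbation

variable {E : Type*} [NormedAddCommGroup E] [InnerProductSpace ℂ E] [CompleteSpace E]
  {A : E →ₗ.[ℂ] E} {U : ℝ → unitary (E →L[ℂ] E)} {B : E →L[ℂ] E}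

omit [CompleteSpace E] in
lemma mem_graph_vadd_iff {x y : E} :
    (x, y) ∈ ((B : E →ₗ[ℂ] E) +ᵥ A).graph ↔ (x, y - B x) ∈ A.graph := by
  simp only [LinearPMap.mem_graph_iff]
  constructor
  · rintro ⟨z, hz, h⟩
    exact ⟨z, hz, by rw [← hz, ← h, LinearPMap.vadd_apply]; simp⟩
  · rintro ⟨z, hz, h⟩
    refine ⟨z, hz, ?_⟩
    have := LinearPMap.vadd_apply (B : E →ₗ[ℂ] E) A z
    rw [this, h, ← hz]
    simp

lemma re_inner_smul_I_eq_zero (hB : IsSelfAdjoint B) (x : E) :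
    (⟪x, Complex.I • B x⟫_ℂ).re = 0 := by
  have h := hB.isSymmetric.im_inner_self_apply x
  rw [inner_smul_right]
  simp at h
  simp [h]

lemma inner_inv_unitary_apply (V : unitary (E →L[ℂ] E)) (x y : E) :
    ⟪x, ((V⁻¹ : unitary (E →L[ℂ] E)) : E →L[ℂ] E) y⟫_ℂ = ⟪(V : E →L[ℂ] E) x, y⟫_ℂ := by
  rw [← inner_unitary_apply V, unitary_apply_inv_self]

namespace IsUnitaryGroupOf

lemma continuous_apply (hU : IsUnitaryGroupOf A U) {X : Type*} [TopologicalSpace X]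
    {g : X → ℝ} {f : X → E} (hg : Continuous g) (hf : Continuous f) :
    Continuous fun s => (U (g s) : E →L[ℂ] E) (f s) :=
  continuous_strong_apply (C := 1) (fun x => (hU.continuous x).comp hg)
    (fun s => ContinuousLinearMap.opNorm_le_bound _ zero_le_one fun x => by
      rw [norm_unitary_apply, one_mul]) hf

/-- A bounded selfadjoint perturbation of a generator of a unitary group is again one. -/
theorem exists_perturbed (hU : IsUnitaryGroupOf A U) (hB : IsSelfAdjoint B) :
    ∃ U' : ℝ → unitary (E →L[ℂ] E), IsUnitaryGroupOf ((B : E →ₗ[ℂ] E) +ᵥ A) U' := by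
  let G : ℝ → E →L[ℂ] E := fun t =>
    Complex.I • ((U (-t) : E →L[ℂ] E) * B * (U t : E →L[ℂ] E))
  have hGapp : ∀ t x, G t x =
      Complex.I • (U (-t) : E →L[ℂ] E) (B ((U t : E →L[ℂ] E) x)) := fun t x => rfl
  have hG : ∀ x, Continuous fun s => G s x := fun x => by
    simp only [hGapp]
    exact (hU.continuous_apply continuous_neg
      (B.continuous.comp (hU.continuous x))).const_smul Complex.I
  have hC : ∀ s, ‖G s‖ ≤ ‖B‖ := fun s =>
    ContinuousLinearMap.opNorm_le_bound _ (norm_nonneg B) fun x => by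
      rw [hGapp, norm_smul, Complex.norm_I, one_mul, norm_unitary_apply]
      refine (B.le_opNorm _).trans_eq ?_
      rw [norm_unitary_apply]
  have hskew : ∀ t x, (⟪x, G t x⟫_ℂ).re = 0 := fun t x => by
    rw [hGapp, ← map_smul, hU.map_neg, inner_inv_unitary_apply]
    exact re_inner_smul_I_eq_zero hB _
  obtain ⟨W, hW0, hW⟩ := exists_propagator hG hC hskew
  have hWcont : ∀ x, Continuous fun s => W s x := fun x =>
    continuous_iff_continuousAt.mpr fun t => (hW x t).continuousAt
  -- Since U(t) G(s+t) = G(s) U(t), both sides solve v' = G(s) v in s with the same initial value.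
  -- This cocycle identity makes U(t)W(t) a group.
  have hcoc : ∀ s t x, (U t : E →L[ℂ] E) (W (s + t) x) = W s ((U t : E →L[ℂ] E) (W t x)) := by
    intro s t x
    refine evolution_unique hskew (w := fun s => (U t : E →L[ℂ] E) (W (s + t) x))
      (fun s => ?_) (hW _) ?_ s
    · have h1 := (hW x (s + t)).comp_add_const s t
      have h2 := ((U t : E →L[ℂ] E).restrictScalars ℝ).hasFDerivAt.comp_hasDerivAt s h1
      refine h2.congr_deriv ?_
      simp only [ContinuousLinearMap.coe_restrictScalars', hGapp, map_smul]
      rw [← hU.add_apply, ← hU.add_apply]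
      rw [show t + -(s + t) = -s by ring]
    · simp [hW0]
  let T : ℝ → E →ₗᵢ[ℂ] E := fun t =>
    (Unitary.linearIsometryEquiv (U t)).toLinearIsometry.comp (W t)
  have hTapp : ∀ t x, T t x = (U t : E →L[ℂ] E) (W t x) := fun t x => rfl
  have hTadd : ∀ s t x, T (s + t) x = T s (T t x) := fun s t x => by
    rw [hTapp, hU.add_apply, hcoc, hTapp, hTapp]
  have hT0 : ∀ x, T 0 x = x := fun x => by
    rw [hTapp, hU.map_zero, hW0, unitary_one_apply]
  -- The group law supplies the inverse T(-t), upgrading the isometry to a unitary.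
  let e : ℝ → E ≃ₗᵢ[ℂ] E := fun t => LinearIsometryEquiv.ofSurjective (T t) fun x =>
    ⟨T (-t) x, by rw [← hTadd, add_neg_cancel, hT0]⟩
  have heapp : ∀ t x, ((Unitary.linearIsometryEquiv.symm (e t) : unitary (E →L[ℂ] E)) :
      E →L[ℂ] E) x = (U t : E →L[ℂ] E) (W t x) := fun t x => rfl
  refine ⟨fun t => Unitary.linearIsometryEquiv.symm (e t), ⟨fun s t => ?_, fun x => ?_,
    fun x y => ?_⟩⟩
  · refine unitary_ext fun x => ?_
    rw [unitary_mul_apply, heapp, heapp, heapp, ← hTapp, hTadd, hTapp, hTapp]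
  · simp only [heapp]
    exact hU.continuous_apply continuous_id (hWcont x)
  · simp only [heapp]
    have hdW : HasDerivAt (fun s => W s x) (Complex.I • B x) 0 := by
      refine (hW x 0).congr_deriv ?_
      rw [hGapp, hW0, neg_zero, hU.map_zero, unitary_one_apply, unitary_one_apply]
    -- In U(s)W(s)x = U(s)x + U(s)(W(s)x - x) the last term is differentiable at 0 for every x. So
    -- the whole is differentiable exactly when U(s)x is, which identifies the domain of the
    -- generator in both directions.
    have hdrem : HasDerivAt (fun s => (U s : E →L[ℂ] E) (W s x - x)) (Complex.I • B x) 0 := by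
      have hz : (U 0 : E →L[ℂ] E) = 1 := by rw [hU.map_zero]; rfl
      refine (HasDerivAt.unitary_apply (D := 0) (fun z => (hU.continuous z).continuousAt) ?_
        (hdW.sub_const x)).congr_deriv ?_
      · simp only [hW0, sub_self, _root_.map_zero]
        exact hasDerivAt_const _ _
      · rw [hz, zero_add]; rfl
    rw [mem_graph_vadd_iff, hU.generator]
    constructor
    · intro h
      refine ((h.add hdrem).congr_of_eventuallyEq (Eventually.of_forall fun s => ?_)).congr_deriv ?_
      · simp
      · rw [smul_sub, sub_add_cancel]
    · intro h
      refine ((h.sub hdrem).congr_of_eventuallyEq (Eventually.of_forall fun s => ?_)).congr_deriv ?_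
      · simp
      · rw [smul_sub]

end IsUnitaryGroupOf

end Perturbation

/-! ### Chernoff and Trotter product formulas. -/

section Trotter

variable {E : Type*} [NormedAddCommGroup E] [InnerProductSpace ℂ E]

/-- For a family of operators of norm `O(h)`, being pointwise `o(h)` may be checked on a dense
set of vectors. -/
lemma isLittleO_apply_of_dense {D : ℝ → E →L[ℂ] E} {C : ℝ} {S : Set E} (hS : Dense S)
    (hC : ∀ h x, ‖D h x‖ ≤ C * |h| * ‖x‖)
    (hD : ∀ x ∈ S, (fun h => D h x) =o[𝓝 0] fun h : ℝ => h) (x : E) :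
    (fun h => D h x) =o[𝓝 0] fun h : ℝ => h := by
  rw [Asymptotics.isLittleO_iff]
  intro ε hε
  have hC' : 0 < |C| + 1 := by positivity
  obtain ⟨z, hz, hxz⟩ := Metric.mem_closure_iff.mp (hS x) (ε / 2 / (|C| + 1)) (by positivity)
  filter_upwards [Asymptotics.isLittleO_iff.mp (hD z hz) (half_pos hε)] with h hh
  have h1 : D h x = D h z + D h (x - z) := by rw [map_sub]; abel
  have h2 : C * |h| * ‖x - z‖ ≤ (|C| + 1) * |h| * (ε / 2 / (|C| + 1)) := by
    rw [dist_eq_norm] at hxz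
    have : C ≤ |C| + 1 := (le_abs_self C).trans (by linarith)
    gcongr
  have h3 : (|C| + 1) * |h| * (ε / 2 / (|C| + 1)) = ε / 2 * |h| := by field_simp
  rw [h1]
  refine (norm_add_le _ _).trans ((add_le_add hh ((hC h _).trans h2)).trans_eq ?_)
  rw [h3, Real.norm_eq_abs]
  ring

variable [CompleteSpace E] {A : E →ₗ.[ℂ] E} {U₀ U V : ℝ → unitary (E →L[ℂ] E)}
  {B : E →L[ℂ] E}

/-- Telescoping through W(Wⁿ - U(nh)) + (W - U(h))U(nh): as W is isometric, the one-step errors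
along the orbit of U simply add up. -/
lemma norm_pow_sub_le (hU : IsUnitaryGroupOf A U) (W : unitary (E →L[ℂ] E)) (h δ : ℝ) (x : E)
    (n : ℕ) (hb : ∀ k < n, ‖(W : E →L[ℂ] E) ((U (k * h) : E →L[ℂ] E) x) -
      (U h : E →L[ℂ] E) ((U (k * h) : E →L[ℂ] E) x)‖ ≤ δ) :
    ‖((W ^ n : unitary (E →L[ℂ] E)) : E →L[ℂ] E) x - (U (n * h) : E →L[ℂ] E) x‖ ≤ n * δ := by
  induction n with
  | zero => simp [hU.map_zero]
  | succ n ih =>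
    have h1 : (U ((n + 1 : ℕ) * h) : E →L[ℂ] E) x =
        (U h : E →L[ℂ] E) ((U (n * h) : E →L[ℂ] E) x) := by
      rw [← hU.add_apply]
      congr 3
      push_cast
      ring
    rw [pow_succ', unitary_mul_apply, h1]
    have h2 := ih fun k hk => hb k (hk.trans (Nat.lt_succ_self n))
    have h3 := hb n (Nat.lt_succ_self n)
    rw [← norm_unitary_apply W, map_sub] at h2
    refine (norm_sub_le_norm_sub_add_norm_sub _ _ _).trans ((add_le_add h2 h3).trans_eq ?_)
    push_cast
    ring

/-- Chernoff's product formula: if a unitary family agrees with a unitary group to first order,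
then its scaled powers converge strongly to the group. -/
theorem tendsto_pow_of_isLittleO (hU : IsUnitaryGroupOf A U) {W : ℝ → unitary (E →L[ℂ] E)}
    {C : ℝ} (hC : ∀ h x, ‖((W h : E →L[ℂ] E) - U h) x‖ ≤ C * |h| * ‖x‖)
    (ho : ∀ x, (fun h => ((W h : E →L[ℂ] E) - U h) x) =o[𝓝 0] fun h : ℝ => h) (t : ℝ) (x : E) :
    Tendsto (fun n : ℕ => ((W (t / n) ^ n : unitary (E →L[ℂ] E)) : E →L[ℂ] E) x) atTop
      (𝓝 ((U t : E →L[ℂ] E) x)) := by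
  have hunif : ∀ ε > 0, ∀ᶠ h in 𝓝 (0 : ℝ), ∀ s ∈ Set.Icc (-|t|) |t|,
      ‖((W h : E →L[ℂ] E) - U h) ((U s : E →L[ℂ] E) x)‖ ≤ ε * |h| := by
    intro ε hε
    -- The orbit over [-|t|, |t|] is compact, and the bound `hC` carries the o(h) estimate at one
    -- orbit point to its neighbours.
    refine isCompact_Icc.eventually_forall_of_forall_eventually fun s _ => ?_
    have hC' : 0 < |C| + 1 := by positivity
    have h1 := Asymptotics.isLittleO_iff.mp (ho ((U s : E →L[ℂ] E) x)) (half_pos hε)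
    have h2 : ∀ᶠ r in 𝓝 s, ‖(U r : E →L[ℂ] E) x - (U s : E →L[ℂ] E) x‖ < ε / 2 / (|C| + 1) := by
      have h := Metric.tendsto_nhds.mp ((hU.continuous x).tendsto s)
        (ε / 2 / (|C| + 1)) (by positivity)
      simpa only [dist_eq_norm] using h
    rw [nhds_prod_eq]
    filter_upwards [h1.prod_mk h2] with z hz
    set D := (W z.1 : E →L[ℂ] E) - U z.1
    have e1 : D ((U z.2 : E →L[ℂ] E) x) = D ((U s : E →L[ℂ] E) x) +
        D ((U z.2 : E →L[ℂ] E) x - (U s : E →L[ℂ] E) x) := by rw [map_sub D]; abel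
    have e2 : C * |z.1| * ‖(U z.2 : E →L[ℂ] E) x - (U s : E →L[ℂ] E) x‖ ≤
        (|C| + 1) * |z.1| * (ε / 2 / (|C| + 1)) := by
      have : C ≤ |C| + 1 := (le_abs_self C).trans (by linarith)
      have := hz.2.le
      gcongr
    have e3 : (|C| + 1) * |z.1| * (ε / 2 / (|C| + 1)) = ε / 2 * |z.1| := by field_simp
    rw [e1]
    refine (norm_add_le _ _).trans ((add_le_add hz.1 ((hC _ _).trans e2)).trans_eq ?_)
    rw [e3, Real.norm_eq_abs]
    ring
  rw [Metric.tendsto_nhds]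
  intro ε hε
  -- The n steps of length |t|/n then cost ε|t|/(|t|+1) in total, strictly below ε even when t = 0.
  have hε' : 0 < ε / (|t| + 1) := by positivity
  filter_upwards [(tendsto_const_div_atTop_nhds_zero_nat t).eventually (hunif _ hε'),
    eventually_gt_atTop 0] with n hn hn0
  have hn0' : (0 : ℝ) < n := Nat.cast_pos.mpr hn0
  have key := norm_pow_sub_le hU (W (t / n)) (t / n) (ε / (|t| + 1) * |t / n|) x n fun k hk => by
    refine hn (k * (t / n)) (abs_le.mp ?_)
    have : (k : ℝ) ≤ n := by exact_mod_cast hk.le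
    rw [abs_mul, abs_div, Nat.abs_cast, Nat.abs_cast, mul_div_left_comm]
    exact mul_le_of_le_one_right (abs_nonneg t) (div_le_one_of_le₀ this hn0'.le)
  rw [mul_div_cancel₀ t hn0'.ne'] at key
  rw [dist_eq_norm]
  refine key.trans_lt ?_
  rw [abs_div, Nat.abs_cast]
  have h4 : (n : ℝ) * (ε / (|t| + 1) * (|t| / n)) = ε * (|t| / (|t| + 1)) := by field_simp
  rw [h4]
  exact mul_lt_of_lt_one_right hε ((div_lt_one (by positivity)).mpr (by linarith))

omit [CompleteSpace E] in
lemma mem_graph_ofBounded_iff {x y : E} : (x, y) ∈ (ofBounded B).graph ↔ y = B x := by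
  simp only [LinearPMap.mem_graph_iff, ofBounded]
  constructor
  · rintro ⟨z, hz, h⟩
    rw [← h, ← hz]
    rfl
  · rintro rfl
    exact ⟨⟨x, trivial⟩, rfl, rfl⟩

namespace IsUnitaryGroupOf

lemma norm_sub_le_of_bounded (hV : IsUnitaryGroupOf (ofBounded B) V) (t : ℝ) (x : E) :
    ‖(V t : E →L[ℂ] E) x - x‖ ≤ ‖B‖ * |t| * ‖x‖ := by
  have h := convex_univ.norm_image_sub_le_of_norm_hasDerivWithin_le
    (C := ‖B‖ * ‖x‖) (x := 0) (y := t)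
    (fun s _ => (hV.hasDerivAt (mem_graph_ofBounded_iff.mpr rfl) s).hasDerivWithinAt)
    (fun s _ => by
      rw [norm_smul, Complex.norm_I, one_mul, norm_unitary_apply]
      exact B.le_opNorm x) (Set.mem_univ _) (Set.mem_univ _)
  rw [hV.map_zero, sub_zero, unitary_one_apply, Real.norm_eq_abs] at h
  exact h.trans_eq (by ring)

/-- Derivative of the propagator in the interaction picture. -/
lemma hasDerivAt_interaction (h₀ : IsUnitaryGroupOf A U₀)
    (hU : IsUnitaryGroupOf ((B : E →ₗ[ℂ] E) +ᵥ A) U) {x y : E} (hx : (x, y) ∈ A.graph) (t : ℝ) :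
    HasDerivAt (fun s => (U₀ (-s) : E →L[ℂ] E) ((U s : E →L[ℂ] E) x))
      (Complex.I • (U₀ (-t) : E →L[ℂ] E) (B ((U t : E →L[ℂ] E) x))) t := by
  have hx' : (x, y + B x) ∈ ((B : E →ₗ[ℂ] E) +ᵥ A).graph := by
    rw [mem_graph_vadd_iff, add_sub_cancel_right]
    exact hx
  have h1 := hU.hasDerivAt hx' t
  have h2 := h₀.hasDerivAt_neg (mem_graph_vadd_iff.mp (hU.apply_mem_graph hx' t)) t
  refine (HasDerivAt.unitary_apply (G := fun s => U₀ (-s))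
    (fun z => ((h₀.continuous z).comp continuous_neg).continuousAt) h2 h1).congr_deriv ?_
  rw [_root_.map_sub, map_smul, smul_sub]
  abel

/-- On the domain the interaction-picture orbit has speed at most ‖B‖‖x‖, the unbounded part having
cancelled; the estimate is closed in x and extends by density. -/
lemma norm_interaction_sub_le (h₀ : IsUnitaryGroupOf A U₀)
    (hU : IsUnitaryGroupOf ((B : E →ₗ[ℂ] E) +ᵥ A) U) (hA : Dense (A.domain : Set E)) (t : ℝ)
    (x : E) : ‖(U₀ (-t) : E →L[ℂ] E) ((U t : E →L[ℂ] E) x) - x‖ ≤ ‖B‖ * |t| * ‖x‖ := by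
  have hcl : IsClosed {x : E | ‖(U₀ (-t) : E →L[ℂ] E) ((U t : E →L[ℂ] E) x) - x‖ ≤
      ‖B‖ * |t| * ‖x‖} := isClosed_le (by fun_prop) (by fun_prop)
  refine hcl.closure_subset_iff.mpr (fun z hz => ?_) (hA x)
  have h := convex_univ.norm_image_sub_le_of_norm_hasDerivWithin_le
    (C := ‖B‖ * ‖z‖) (x := 0) (y := t)
    (fun s _ => (h₀.hasDerivAt_interaction hU (A.mem_graph ⟨z, hz⟩) s).hasDerivWithinAt)
    (fun s _ => by
      rw [norm_smul, Complex.norm_I, one_mul, norm_unitary_apply]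
      refine (B.le_opNorm _).trans_eq ?_
      rw [norm_unitary_apply]) (Set.mem_univ _) (Set.mem_univ _)
  rw [hU.map_zero, neg_zero, h₀.map_zero, sub_zero, unitary_one_apply, unitary_one_apply,
    Real.norm_eq_abs] at h
  exact h.trans_eq (by ring)

/-- The interaction picture propagator differs from the group of the perturbation by `O(h)`. -/
lemma norm_interaction_sub_group_le (h₀ : IsUnitaryGroupOf A U₀)
    (hU : IsUnitaryGroupOf ((B : E →ₗ[ℂ] E) +ᵥ A) U) (hV : IsUnitaryGroupOf (ofBounded B) V)
    (hA : Dense (A.domain : Set E)) (h : ℝ) (x : E) :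
    ‖(((U₀ (-h) * U h : unitary (E →L[ℂ] E)) : E →L[ℂ] E) - V h) x‖ ≤
      2 * ‖B‖ * |h| * ‖x‖ := by
  have h1 := h₀.norm_interaction_sub_le hU hA h x
  have h2 := hV.norm_sub_le_of_bounded h x
  rw [norm_sub_rev] at h2
  refine (norm_sub_le_norm_sub_add_norm_sub _ x _).trans ((add_le_add h1 h2).trans_eq ?_)
  ring

/-- The interaction picture propagator agrees with the group of the perturbation to first order. -/
lemma isLittleO_interaction_sub_group (h₀ : IsUnitaryGroupOf A U₀)
    (hU : IsUnitaryGroupOf ((B : E →ₗ[ℂ] E) +ᵥ A) U) (hV : IsUnitaryGroupOf (ofBounded B) V)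
    (hA : Dense (A.domain : Set E)) (x : E) :
    (fun h => (((U₀ (-h) * U h : unitary (E →L[ℂ] E)) : E →L[ℂ] E) - V h) x) =o[𝓝 0]
      fun h : ℝ => h := by
  refine isLittleO_apply_of_dense (C := 2 * ‖B‖) hA
    (h₀.norm_interaction_sub_group_le hU hV hA) (fun z hz => ?_) x
  have h1 := h₀.hasDerivAt_interaction hU (A.mem_graph ⟨z, hz⟩) 0
  have h2 := hV.hasDerivAt (mem_graph_ofBounded_iff.mpr (rfl : B z = B z)) 0
  have h3 := hasDerivAt_iff_isLittleO.mp (h1.sub h2)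
  simpa [hU.map_zero, h₀.map_zero, hV.map_zero] using h3

/-- Trotter's product formula for a bounded perturbation. -/
theorem tendsto_trotter (h₀ : IsUnitaryGroupOf A U₀)
    (hU : IsUnitaryGroupOf ((B : E →ₗ[ℂ] E) +ᵥ A) U) (hV : IsUnitaryGroupOf (ofBounded B) V)
    (hA : Dense (A.domain : Set E)) (t : ℝ) (x : E) :
    Tendsto (fun n : ℕ => (((U₀ (t / n) * V (t / n)) ^ n : unitary (E →L[ℂ] E)) : E →L[ℂ] E) x)
      atTop (𝓝 ((U t : E →L[ℂ] E) x)) := by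
  -- Applying the isometry U₀(-h) turns the Trotter error into the interaction-picture error already
  -- estimated.
  have key : ∀ h x, ‖(((U₀ h * V h : unitary (E →L[ℂ] E)) : E →L[ℂ] E) - U h) x‖ =
      ‖(((U₀ (-h) * U h : unitary (E →L[ℂ] E)) : E →L[ℂ] E) - V h) x‖ := fun h x => by
    simp only [_root_.sub_apply, unitary_mul_apply]
    rw [← norm_unitary_apply (U₀ (-h)), _root_.map_sub, h₀.map_neg, unitary_inv_apply_self,
      norm_sub_rev]
  refine tendsto_pow_of_isLittleO (W := fun h => U₀ h * V h) hU (C := 2 * ‖B‖) (fun h x => ?_)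
    (fun x => ?_) t x
  · rw [key]
    exact h₀.norm_interaction_sub_group_le hU hV hA h x
  · rw [← Asymptotics.isLittleO_norm_left]
    simp only [key]
    exact (h₀.isLittleO_interaction_sub_group hU hV hA x).norm_left

/-- The group of a bounded perturbation is recovered from the perturbed and unperturbed groups. -/
theorem tendsto_interaction_pow (h₀ : IsUnitaryGroupOf A U₀)
    (hU : IsUnitaryGroupOf ((B : E →ₗ[ℂ] E) +ᵥ A) U) (hV : IsUnitaryGroupOf (ofBounded B) V)
    (hA : Dense (A.domain : Set E)) (t : ℝ) (x : E) :
    Tendsto (fun n : ℕ =>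
        (((U₀ (-(t / n)) * U (t / n)) ^ n : unitary (E →L[ℂ] E)) : E →L[ℂ] E) x)
      atTop (𝓝 ((V t : E →L[ℂ] E) x)) :=
  tendsto_pow_of_isLittleO (W := fun h => U₀ (-h) * U h) hV
    (h₀.norm_interaction_sub_group_le hU hV hA) (h₀.isLittleO_interaction_sub_group hU hV hA) t x

end IsUnitaryGroupOf

omit [CompleteSpace E] in
lemma vadd_ofBounded_zero : (B : E →ₗ[ℂ] E) +ᵥ ofBounded (0 : E →L[ℂ] E) = ofBounded B := by
  refine LinearPMap.eq_of_eq_graph (Submodule.ext fun z => ?_)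
  obtain ⟨x, y⟩ := z
  rw [mem_graph_vadd_iff, mem_graph_ofBounded_iff, mem_graph_ofBounded_iff]
  simp [sub_eq_zero]

/-- Bounded selfadjoint operators generate unitary groups. -/
lemma exists_isUnitaryGroupOf_ofBounded (hB : IsSelfAdjoint B) :
    ∃ V : ℝ → unitary (E →L[ℂ] E), IsUnitaryGroupOf (ofBounded B) V := by
  have h₀ : IsUnitaryGroupOf (ofBounded (0 : E →L[ℂ] E)) fun _ => 1 :=
    ⟨fun _ _ => (one_mul 1).symm, fun x => continuous_const, fun x y => by
      rw [mem_graph_ofBounded_iff]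
      simp only [unitary_one_apply, _root_.zero_apply]
      constructor
      · rintro rfl
        simpa using hasDerivAt_const (0 : ℝ) x
      · intro h
        simpa using h.unique (hasDerivAt_const (0 : ℝ) x)⟩
  rw [← vadd_ofBounded_zero]
  exact h₀.exists_perturbed hB

end Trotter

/-! ### Eigenbases, diagonal unitary groups and recurrence. -/

section PurePoint

variable {E : Type*} [NormedAddCommGroup E] [InnerProductSpace ℂ E] [CompleteSpace E]
  {A : E →ₗ.[ℂ] E}

/-- Maximality in the equation A = A†: symmetry against the whole graph already forces membership.
This is how vectors are shown to lie in the domain. -/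
lemma mem_graph_iff_of_isSelfAdjoint (hA : IsSelfAdjoint A) {x y : E} :
    (x, y) ∈ A.graph ↔ ∀ a b, (a, b) ∈ A.graph → ⟪b, x⟫_ℂ = ⟪a, y⟫_ℂ := by
  have h := LinearPMap.adjoint_graph_eq_graph_adjoint hA.dense_domain
  rw [LinearPMap.isSelfAdjoint_def.mp hA] at h
  conv_lhs => rw [h]
  rw [Submodule.mem_adjoint_iff]
  simp only [sub_eq_zero]

/-- The eigenspace of an unbounded operator at a real number. -/
def realEigenspace (A : E →ₗ.[ℂ] E) (r : ℝ) : Submodule ℂ E where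
  carrier := {x | (x, (r : ℂ) • x) ∈ A.graph}
  add_mem' {x y} hx hy := by
    have := A.graph.add_mem hx hy
    rwa [Prod.mk_add_mk, ← smul_add] at this
  zero_mem' := by
    change ((0 : E), (r : ℂ) • (0 : E)) ∈ A.graph
    rw [smul_zero]
    exact A.graph.zero_mem
  smul_mem' c x hx := by
    have := A.graph.smul_mem c hx
    rwa [Prod.smul_mk, smul_comm] at this

omit [CompleteSpace E] in
lemma mem_realEigenspace {r : ℝ} {x : E} :
    x ∈ realEigenspace A r ↔ (x, (r : ℂ) • x) ∈ A.graph := Iff.rfl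

lemma isClosed_realEigenspace (hA : IsSelfAdjoint A) (r : ℝ) :
    IsClosed (realEigenspace A r : Set E) :=
  IsClosed.preimage (f := fun x : E => (x, (r : ℂ) • x)) (by fun_prop) hA.isClosed

lemma im_eq_zero_of_eigenvector (hA : IsSelfAdjoint A) {x : E} (hx : x ≠ 0) {c : ℂ}
    (h : (x, c • x) ∈ A.graph) : c.im = 0 := by
  have h1 := (mem_graph_iff_of_isSelfAdjoint hA).mp h _ _ h
  rw [inner_smul_left, inner_smul_right] at h1
  exact Complex.conj_eq_iff_im.mp (mul_right_cancel₀ (inner_self_ne_zero.mpr hx) h1)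

lemma orthogonalFamily_realEigenspace (hA : IsSelfAdjoint A) :
    OrthogonalFamily ℂ (fun r => realEigenspace A r) fun r => (realEigenspace A r).subtypeₗᵢ := by
  rintro r s hrs ⟨x, hx⟩ ⟨y, hy⟩
  have h1 := (mem_graph_iff_of_isSelfAdjoint hA).mp hy _ _ hx
  rw [inner_smul_left, inner_smul_right, Complex.conj_ofReal] at h1
  by_contra h
  exact hrs (Complex.ofReal_injective (mul_right_cancel₀ h h1))

/-- A selfadjoint operator with pure point spectrum has a Hilbert basis of eigenvectors. -/
theorem exists_hilbertBasis_eigenvectors.{u} {E : Type u} [NormedAddCommGroup E]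
    [InnerProductSpace ℂ E] [CompleteSpace E] {A : E →ₗ.[ℂ] E} (hA : IsSelfAdjoint A)
    (hpp : HasPurePointSpectrum A) :
    ∃ (ι : Type u) (b : HilbertBasis ι ℂ E) (ev : ι → ℝ),
      ∀ i, (b i, (ev i : ℂ) • b i) ∈ A.graph := by
  have hcomp : ∀ r, CompleteSpace (realEigenspace A r) := fun r =>
    (isClosed_realEigenspace hA r).completeSpace_coe
  choose w b hb using fun r => exists_hilbertBasis ℂ (realEigenspace A r)
  have hv := (orthogonalFamily_realEigenspace hA).orthonormal_sigma_orthonormal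
    (fun r => (b r).orthonormal)
  refine ⟨Σ r, w r, HilbertBasis.mkOfOrthogonalEqBot hv ?_, fun i => i.1, fun i => ?_⟩
  · rw [Submodule.eq_bot_iff]
    intro x hx
    rw [Submodule.mem_orthogonal'] at hx
    -- Expanding z in the basis of its eigenspace passes from the basis vectors to all eigenvectors,
    -- whose span is dense.
    have h1 : ∀ r, ∀ z ∈ realEigenspace A r, ⟪x, z⟫_ℂ = 0 := by
      intro r z hz
      have h2 := ((b r).hasSum_repr ⟨z, hz⟩).mapL
        ((innerSL ℂ x).comp (realEigenspace A r).subtypeL)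
      refine h2.unique ?_
      convert! hasSum_zero using 1
      funext i
      have h3 := hx _ (Submodule.subset_span ⟨⟨r, i⟩, rfl⟩)
      simp only [Submodule.coe_subtypeₗᵢ, Submodule.subtype_apply] at h3
      simp [h3]
    refine hpp.eq_zero_of_inner_left (𝕜 := ℂ) fun z hz => ?_
    induction hz using Submodule.span_induction with
    | mem z hz =>
      obtain ⟨hz0, c, hc⟩ := hz
      refine h1 c.re z ?_
      rw [mem_realEigenspace]
      convert! hc using 3
      exact Complex.ext rfl (im_eq_zero_of_eigenvector hA hz0 hc).symm
    | zero => simp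
    | add y z _ _ hy hz => rw [inner_add_right, hy, hz, add_zero]
    | smul c z _ hz => rw [inner_smul_right, hz, mul_zero]
  · rw [HilbertBasis.coe_mkOfOrthogonalEqBot]
    exact (b i.1 i.2).2

/-- Strong convergence of unitaries may be checked on a Hilbert basis. -/
lemma tendsto_unitary_apply_of_hilbertBasis {ι : Type*} (b : HilbertBasis ι ℂ E) {α : Type*}
    {l : Filter α} {G : α → unitary (E →L[ℂ] E)} {V : unitary (E →L[ℂ] E)}
    (h : ∀ i, Tendsto (fun a => (G a : E →L[ℂ] E) (b i)) l (𝓝 ((V : E →L[ℂ] E) (b i)))) (x : E) :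
    Tendsto (fun a => (G a : E →L[ℂ] E) x) l (𝓝 ((V : E →L[ℂ] E) x)) := by
  have hspan : ∀ z ∈ Submodule.span ℂ (Set.range b),
      Tendsto (fun a => (G a : E →L[ℂ] E) z) l (𝓝 ((V : E →L[ℂ] E) z)) := by
    intro z hz
    induction hz using Submodule.span_induction with
    | mem z hz =>
      obtain ⟨i, rfl⟩ := hz
      exact h i
    | zero => simp [tendsto_const_nhds]
    | add y z _ _ hy hz => simpa only [map_add] using hy.add hz
    | smul c z _ hz => simpa only [map_smul] using hz.const_smul c
  have hx : x ∈ closure (Submodule.span ℂ (Set.range b) : Set E) := by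
    rw [← Submodule.topologicalClosure_coe, b.dense_span]
    trivial
  rw [Metric.tendsto_nhds]
  intro ε hε
  obtain ⟨z, hz, hxz⟩ := Metric.mem_closure_iff.mp hx (ε / 3) (by positivity)
  filter_upwards [Metric.tendsto_nhds.mp (hspan z hz) (ε / 3) (by positivity)] with a ha
  have h1 : dist ((G a : E →L[ℂ] E) x) ((G a : E →L[ℂ] E) z) = dist x z := by
    rw [dist_eq_norm, ← map_sub, norm_unitary_apply, dist_eq_norm]
  have h2 : dist ((V : E →L[ℂ] E) z) ((V : E →L[ℂ] E) x) = dist x z := by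
    rw [dist_comm, dist_eq_norm, ← map_sub, norm_unitary_apply, dist_eq_norm]
  have h3 := dist_triangle4 ((G a : E →L[ℂ] E) x) ((G a : E →L[ℂ] E) z)
    ((V : E →L[ℂ] E) z) ((V : E →L[ℂ] E) x)
  linarith

section Diagonal

variable {ι : Type*} (b : HilbertBasis ι ℂ E)

omit [CompleteSpace E] in
lemma HilbertBasis.ext_inner {x y : E} (h : ∀ i, ⟪b i, x⟫_ℂ = ⟪b i, y⟫_ℂ) : x = y := by
  refine b.repr.injective (lp.ext (funext fun i => ?_))
  rw [b.repr_apply_apply, b.repr_apply_apply, h]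

/-- There is a unitary acting diagonally on a Hilbert basis with prescribed phases. -/
lemma exists_diagonal_unitary (c : ι → Circle) :
    ∃ V : unitary (E →L[ℂ] E), ∀ i, (V : E →L[ℂ] E) (b i) = (c i : ℂ) • b i := by
  have hv : Orthonormal ℂ fun i => (c i : ℂ) • b i := by
    refine ⟨fun i => ?_, fun i j hij => ?_⟩
    · rw [norm_smul, Circle.norm_coe, one_mul, b.orthonormal.1]
    · change ⟪(c i : ℂ) • b i, (c j : ℂ) • b j⟫_ℂ = 0
      rw [inner_smul_left, inner_smul_right, b.orthonormal.2 hij, mul_zero, mul_zero]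
  have hbot : (Submodule.span ℂ (Set.range fun i => (c i : ℂ) • b i))ᗮ = ⊥ := by
    rw [Submodule.eq_bot_iff]
    intro x hx
    refine HilbertBasis.ext_inner b fun i => ?_
    have h := (Submodule.mem_orthogonal _ x).mp hx _ (Submodule.subset_span ⟨i, rfl⟩)
    rw [inner_smul_left] at h
    rw [inner_zero_right]
    exact (mul_eq_zero.mp h).resolve_left (by simp)
  classical
  let b' := HilbertBasis.mkOfOrthogonalEqBot hv hbot
  refine ⟨Unitary.linearIsometryEquiv.symm (b.repr.trans b'.repr.symm), fun i => ?_⟩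
  change b'.repr.symm (b.repr (b i)) = _
  rw [b.repr_self, b'.repr_symm_single, HilbertBasis.coe_mkOfOrthogonalEqBot]

lemma inner_diagonal_unitary {c : ι → Circle} {V : unitary (E →L[ℂ] E)}
    (hV : ∀ i, (V : E →L[ℂ] E) (b i) = (c i : ℂ) • b i) (i : ι) (x : E) :
    ⟪b i, (V : E →L[ℂ] E) x⟫_ℂ = c i * ⟪b i, x⟫_ℂ := by
  have h := inner_unitary_apply V (b i) x
  rw [hV, inner_smul_left] at h
  rw [← h, ← mul_assoc, Complex.mul_conj, Circle.normSq_coe, Complex.ofReal_one, one_mul]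

end Diagonal

/-- A selfadjoint operator with an eigenbasis generates a diagonal unitary group. -/
theorem exists_isUnitaryGroupOf_diagonal {ι : Type*} (hA : IsSelfAdjoint A)
    (b : HilbertBasis ι ℂ E) {ev : ι → ℝ} (hev : ∀ i, (b i, (ev i : ℂ) • b i) ∈ A.graph) :
    ∃ U : ℝ → unitary (E →L[ℂ] E), IsUnitaryGroupOf A U ∧
      ∀ t i, (U t : E →L[ℂ] E) (b i) = (Circle.exp (t * ev i) : ℂ) • b i := by
  choose U hU using fun t : ℝ => exists_diagonal_unitary b fun i => Circle.exp (t * ev i)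
  have hin : ∀ t i x, ⟪b i, (U t : E →L[ℂ] E) x⟫_ℂ = Circle.exp (t * ev i) * ⟪b i, x⟫_ℂ :=
    fun t i x => inner_diagonal_unitary b (hU t) i x
  have hcoord : ∀ {x y}, (x, y) ∈ A.graph → ∀ i, ⟪b i, y⟫_ℂ = ev i * ⟪b i, x⟫_ℂ := by
    intro x y hxy i
    have h := (mem_graph_iff_of_isSelfAdjoint hA).mp hxy _ _ (hev i)
    rw [← h, inner_smul_left, Complex.conj_ofReal]
  have hphase : ∀ i (t : ℝ), HasDerivAt (fun s : ℝ => (Circle.exp (s * ev i) : ℂ))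
      (Complex.I * ev i * Circle.exp (t * ev i)) t := by
    intro i t
    simp only [Circle.coe_exp]
    have h1 : HasDerivAt (fun s : ℝ => ((s * ev i : ℝ) : ℂ) * Complex.I)
        (ev i * Complex.I) t := by
      have h2 := (((hasDerivAt_id t).mul_const (ev i)).ofReal_comp).mul_const Complex.I
      simpa using h2
    refine h1.cexp.congr_deriv ?_
    ring
  have hcont : ∀ x, Continuous fun t => (U t : E →L[ℂ] E) x := fun x =>
    continuous_iff_continuousAt.mpr fun t =>
      tendsto_unitary_apply_of_hilbertBasis b (fun i => by
        simp only [hU]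
        exact ((hphase i t).continuousAt.tendsto).smul_const _) x
  have hU0 : U 0 = 1 := unitary_ext fun x => HilbertBasis.ext_inner b fun i => by
    rw [hin]; simp
  refine ⟨U, ⟨fun s t => ?_, hcont, fun x y => ⟨fun h => ?_, fun h => ?_⟩⟩, hU⟩
  · refine unitary_ext fun x => HilbertBasis.ext_inner b fun i => ?_
    rw [unitary_mul_apply, hin, hin, hin, add_mul, Circle.exp_add, Circle.coe_mul, mul_assoc]
  · have hc : Continuous fun s => Complex.I • (U s : E →L[ℂ] E) y := (hcont y).const_smul _
    have hint : ∀ t, HasDerivAt (fun t => ∫ s in (0 : ℝ)..t, Complex.I • (U s : E →L[ℂ] E) y)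
        (Complex.I • (U t : E →L[ℂ] E) y) t := fun t =>
      (hc.integral_hasStrictDerivAt 0 t).hasDerivAt
    -- Coordinatewise both sides have the same derivative. The integral form then gives strong
    -- differentiability at once.
    have heq : ∀ t, (U t : E →L[ℂ] E) x =
        x + ∫ s in (0 : ℝ)..t, Complex.I • (U s : E →L[ℂ] E) y := by
      intro t
      refine HilbertBasis.ext_inner b fun i => ?_
      have h1 : ∀ t, HasDerivAt (fun t => Circle.exp (t * ev i) * ⟪b i, x⟫_ℂ -
          ⟪b i, x + ∫ s in (0 : ℝ)..t, Complex.I • (U s : E →L[ℂ] E) y⟫_ℂ) 0 t := by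
        intro t
        have h2 := (hasDerivAt_const t (b i)).inner ℂ ((hint t).const_add x)
        refine (((hphase i t).mul_const ⟪b i, x⟫_ℂ).sub h2).congr_deriv ?_
        rw [inner_zero_left, add_zero, inner_smul_right, hin, hcoord h]
        ring
      have h3 := is_const_of_deriv_eq_zero (fun t => (h1 t).differentiableAt)
        (fun t => (h1 t).deriv) t 0
      rw [hin]
      refine sub_eq_zero.mp (h3.trans ?_)
      simp
    simp only [heq]
    refine ((hint 0).const_add x).congr_deriv ?_
    rw [hU0, unitary_one_apply]
  · have h1 : ∀ i, ⟪b i, y⟫_ℂ = ev i * ⟪b i, x⟫_ℂ := by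
      intro i
      have h2 := (hasDerivAt_const (0 : ℝ) (b i)).inner ℂ h
      simp only [hin, inner_zero_left, add_zero, inner_smul_right] at h2
      have h3 := h2.unique ((hphase i 0).mul_const ⟪b i, x⟫_ℂ)
      rw [zero_mul, Circle.exp_zero, Circle.coe_one, mul_one, mul_assoc] at h3
      exact mul_left_cancel₀ Complex.I_ne_zero h3
    -- Parseval expands both inner products; the coefficients agree because the eigenvalues are
    -- real.
    rw [mem_graph_iff_of_isSelfAdjoint hA]
    intro a a' ha
    refine (b.hasSum_inner_mul_inner a' x).unique ?_
    convert! b.hasSum_inner_mul_inner a y using 1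
    funext i
    rw [h1, ← inner_conj_symm a', hcoord ha, map_mul, Complex.conj_ofReal, inner_conj_symm]
    ring

/-- Almost periodicity of diagonal unitary groups. -/
lemma exists_recurrence {ι : Type*} (b : HilbertBasis ι ℂ E) {ev : ι → ℝ}
    {U : ℝ → unitary (E →L[ℂ] E)}
    (hU : ∀ t i, (U t : E →L[ℂ] E) (b i) = (Circle.exp (t * ev i) : ℂ) • b i) (τ : ℝ) :
    ∃ l : Filter ℕ, l.NeBot ∧ l ≤ atTop ∧
      ∀ x, Tendsto (fun n : ℕ => (U (n * τ) : E →L[ℂ] E) x) l (𝓝 x) := by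
  -- Powers of an element of the compact group `ι → Circle` cluster at 1, so all eigenphases return
  -- simultaneously along one ultrafilter.
  obtain ⟨l, hl, ht⟩ := mapClusterPt_iff_ultrafilter.mp
    (mapClusterPt_one_atTop_pow fun i => Circle.exp (τ * ev i))
  refine ⟨l, inferInstance, hl, fun x => ?_⟩
  refine tendsto_unitary_apply_of_hilbertBasis (V := 1) b (fun i => ?_) x
  have h1 := (tendsto_pi_nhds.mp ht i)
  have h2 := ((continuous_subtype_val.tendsto _).comp h1).smul_const (b i)
  simp only [Pi.one_apply, Circle.coe_one, one_smul] at h2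
  refine h2.congr fun n => ?_
  rw [hU]
  simp only [Function.comp, Pi.pow_apply]
  rw [mul_assoc, ← nsmul_eq_mul, Circle.exp_nsmul]

end PurePoint

/-! ### The strong topology on the unitary group. -/

section StrongTopology

variable {E : Type*} [NormedAddCommGroup E] [InnerProductSpace ℂ E] [CompleteSpace E]

lemma tendsto_strong_iff {α : Type*} {l : Filter α} {G : α → unitary (E →L[ℂ] E)}
    {V : unitary (E →L[ℂ] E)} :
    Tendsto G l (@nhds _ (strongTopology E) V) ↔
      ∀ x, Tendsto (fun a => (G a : E →L[ℂ] E) x) l (𝓝 ((V : E →L[ℂ] E) x)) := by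
  rw [@nhds_induced, tendsto_comap_iff, tendsto_pi_nhds]
  rfl

lemma mem_strong_closure_of_tendsto {α : Type*} {l : Filter α} [l.NeBot]
    {G : α → unitary (E →L[ℂ] E)} {V : unitary (E →L[ℂ] E)} {S : Set (unitary (E →L[ℂ] E))}
    (h : ∀ x, Tendsto (fun a => (G a : E →L[ℂ] E) x) l (𝓝 ((V : E →L[ℂ] E) x)))
    (hG : ∀ᶠ a in l, G a ∈ S) : V ∈ closure[strongTopology E] S := by
  let := strongTopology E
  exact mem_closure_of_tendsto (tendsto_strong_iff.mpr h) hG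

lemma mem_of_isClosed_strong_of_tendsto {α : Type*} {l : Filter α} [l.NeBot]
    {G : α → unitary (E →L[ℂ] E)} {V : unitary (E →L[ℂ] E)} {S : Set (unitary (E →L[ℂ] E))}
    (hS : IsClosed[strongTopology E] S)
    (h : ∀ x, Tendsto (fun a => (G a : E →L[ℂ] E) x) l (𝓝 ((V : E →L[ℂ] E) x)))
    (hG : ∀ᶠ a in l, G a ∈ S) : V ∈ S := by
  rw [← @IsClosed.closure_eq _ (strongTopology E) _ hS]
  exact mem_strong_closure_of_tendsto h hG

lemma continuous_strong_iff {f : unitary (E →L[ℂ] E) → unitary (E →L[ℂ] E)} :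
    Continuous[strongTopology E, strongTopology E] f ↔ ∀ V x,
      Tendsto (fun W => (f W : E →L[ℂ] E) x) (@nhds _ (strongTopology E) V)
        (𝓝 ((f V : E →L[ℂ] E) x)) := by
  rw [@continuous_iff_continuousAt _ _ (strongTopology E) (strongTopology E)]
  exact forall_congr' fun V => tendsto_strong_iff

lemma tendsto_strong_apply (V : unitary (E →L[ℂ] E)) (x : E) :
    Tendsto (fun W : unitary (E →L[ℂ] E) => (W : E →L[ℂ] E) x) (@nhds _ (strongTopology E) V)
      (𝓝 ((V : E →L[ℂ] E) x)) :=
  tendsto_strong_iff.mp tendsto_id x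

lemma continuous_strong_mul_left (V : unitary (E →L[ℂ] E)) :
    Continuous[strongTopology E, strongTopology E] fun W => V * W :=
  continuous_strong_iff.mpr fun W x =>
    ((V : E →L[ℂ] E).continuous.tendsto _).comp (tendsto_strong_apply W x)

lemma continuous_strong_mul_right (V : unitary (E →L[ℂ] E)) :
    Continuous[strongTopology E, strongTopology E] fun W => W * V :=
  continuous_strong_iff.mpr fun W x => tendsto_strong_apply W ((V : E →L[ℂ] E) x)

/-- For unitaries, ‖W⁻¹x - V⁻¹x‖ = ‖x - WV⁻¹x‖, which tends to 0 by strong convergence at the single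
vector V⁻¹x. -/
lemma continuous_strong_inv :
    Continuous[strongTopology E, strongTopology E] fun W : unitary (E →L[ℂ] E) => W⁻¹ := by
  refine continuous_strong_iff.mpr fun V x => ?_
  have h := tendsto_iff_norm_sub_tendsto_zero.mp
    (tendsto_strong_apply V (((V⁻¹ : unitary (E →L[ℂ] E)) : E →L[ℂ] E) x))
  refine tendsto_iff_norm_sub_tendsto_zero.mpr (h.congr fun W => ?_)
  rw [← norm_unitary_apply W (((W⁻¹ : unitary (E →L[ℂ] E)) : E →L[ℂ] E) x - _), map_sub,
    unitary_apply_inv_self, unitary_apply_inv_self, norm_sub_rev]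

/-- The strong closure of a semigroup of unitaries is a semigroup. -/
lemma mul_mem_strong_closure (S : Subsemigroup (unitary (E →L[ℂ] E)))
    {V W : unitary (E →L[ℂ] E)} (hV : V ∈ closure[strongTopology E] (S : Set _))
    (hW : W ∈ closure[strongTopology E] (S : Set _)) :
    V * W ∈ closure[strongTopology E] (S : Set _) := by
  let := strongTopology E
  -- Separate continuity of multiplication suffices when the closure is taken one factor at a time.
  have h1 : ∀ a ∈ S, ∀ W ∈ closure (S : Set (unitary (E →L[ℂ] E))), a * W ∈ closure (S : Set _) :=
    fun a ha W hW => map_mem_closure (continuous_strong_mul_left a) hW fun c hc => S.mul_mem ha hc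
  have h2 := map_mem_closure (continuous_strong_mul_right W) hV
    (t := closure (S : Set (unitary (E →L[ℂ] E)))) fun a ha => h1 a ha W hW
  rwa [closure_closure] at h2

end StrongTopology

/-! ### Reachability of the drift and control groups. -/

section Reachability

variable {E : Type*} [NormedAddCommGroup E] [InnerProductSpace ℂ E] [CompleteSpace E]

/-- Trades control amplitude for time, for c of any sign including zero. -/
lemma IsUnitaryGroupOf.smul {B : E →L[ℂ] E} {V : ℝ → unitary (E →L[ℂ] E)}
    (hV : IsUnitaryGroupOf (ofBounded B) V) (c : ℝ) :
    IsUnitaryGroupOf (ofBounded ((c : ℂ) • B)) fun t => V (c * t) where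
  map_add s t := by rw [mul_add, hV.map_add]
  continuous x := (hV.continuous x).comp (continuous_const.mul continuous_id)
  generator x y := by
    have h1 : HasDerivAt (fun t : ℝ => (V (c * t) : E →L[ℂ] E) x)
        (Complex.I • ((c : ℂ) • B) x) 0 := by
      have h2 := (hV.generator x (B x)).mp (mem_graph_ofBounded_iff.mpr rfl)
      have h3 : HasDerivAt (fun t : ℝ => c * t) c 0 := by
        simpa using (hasDerivAt_id (0 : ℝ)).const_mul c
      have h4 := HasDerivAt.scomp_of_eq (0 : ℝ) h2 h3 (mul_zero c).symm
      refine h4.congr_deriv ?_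
      rw [_root_.smul_apply, smul_comm, Complex.coe_smul]
    rw [mem_graph_ofBounded_iff]
    constructor
    · rintro rfl
      exact h1
    · intro h
      exact smul_right_injective E Complex.I_ne_zero (h.unique h1)

variable {N : ℕ} {H₀ : E →ₗ.[ℂ] E} {Hc : Fin N → E →L[ℂ] E}

lemma isSelfAdjoint_ofReal_smul {B : E →L[ℂ] E} (hB : IsSelfAdjoint B) (c : ℝ) :
    IsSelfAdjoint ((c : ℂ) • B) :=
  IsSelfAdjoint.smul (Complex.conj_ofReal c) hB

omit [CompleteSpace E] in
lemma hamiltonian_zero : hamiltonian H₀ Hc 0 = H₀ := by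
  simp [hamiltonian]

omit [CompleteSpace E] in
lemma hamiltonian_single (j : Fin N) (c : ℝ) :
    hamiltonian H₀ Hc (Pi.single j c) = (((c : ℂ) • Hc j : E →L[ℂ] E) : E →ₗ[ℂ] E) +ᵥ H₀ := by
  rw [hamiltonian, Finset.sum_eq_single j]
  · rw [Pi.single_eq_same]
  · intro i _ hi
    rw [Pi.single_eq_of_ne hi, Complex.ofReal_zero, zero_smul]
  · simp

/-- A strongly closed group containing the groups of the drift and the controls contains the
groups of all Hamiltonians. -/
theorem mem_of_isExp_hamiltonian {U₀ : ℝ → unitary (E →L[ℂ] E)} (hU₀ : IsUnitaryGroupOf H₀ U₀)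
    (hdom : Dense (H₀.domain : Set E)) (hHc : ∀ j, IsSelfAdjoint (Hc j))
    {K : Subgroup (unitary (E →L[ℂ] E))} (hK : IsClosed[strongTopology E] (K : Set _))
    (hK₀ : ∀ t V, IsExp H₀ t V → V ∈ K) (hKc : ∀ j t V, IsExp (ofBounded (Hc j)) t V → V ∈ K)
    {y : Fin N → ℝ} {τ : ℝ} {V : unitary (E →L[ℂ] E)} (hV : IsExp (hamiltonian H₀ Hc y) τ V) :
    V ∈ K := by
  have key : ∀ s : Finset (Fin N), ∃ U : ℝ → unitary (E →L[ℂ] E),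
      IsUnitaryGroupOf
        (((∑ j ∈ s, (y j : ℂ) • Hc j : E →L[ℂ] E) : E →ₗ[ℂ] E) +ᵥ H₀) U ∧ ∀ t, U t ∈ K := by
    intro s
    induction s using Finset.induction_on with
    | empty =>
      refine ⟨U₀, ?_, fun t => hK₀ t _ ⟨U₀, hU₀, rfl⟩⟩
      simpa using hU₀
    | insert j s hj ih =>
      obtain ⟨U, hU, hUK⟩ := ih
      obtain ⟨Y, hY⟩ := hU.exists_perturbed (isSelfAdjoint_ofReal_smul (hHc j) (y j))
      obtain ⟨W, hW⟩ := exists_isUnitaryGroupOf_ofBounded (hHc j)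
      refine ⟨Y, ?_, fun t => ?_⟩
      · rw [Finset.sum_insert hj, ContinuousLinearMap.toLinearMap_add, add_vadd]
        exact hY
      -- Adding bounded operators leaves the domain unchanged, so `hdom` serves for every partial
      -- sum.
      · refine mem_of_isClosed_strong_of_tendsto hK
          (hU.tendsto_trotter hY (hW.smul (y j)) hdom t) (Eventually.of_forall fun n => ?_)
        exact K.pow_mem (K.mul_mem (hUK _) (hKc j _ _ ⟨W, hW, rfl⟩)) n
  obtain ⟨U, hU, hUK⟩ := key Finset.univ
  obtain ⟨U', hU', rfl⟩ := hV
  rw [hU'.unique hU hdom]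
  exact hUK τ

lemma mem_stronglyReachableSet_of_isUnitaryGroupOf {y : Fin N → ℝ}
    {U : ℝ → unitary (E →L[ℂ] E)} (hU : IsUnitaryGroupOf (hamiltonian H₀ Hc y) U) {t : ℝ}
    (ht : 0 < t) : U t ∈ stronglyReachableSet H₀ Hc :=
  @subset_closure _ (strongTopology E) _ _ (Subsemigroup.subset_closure ⟨t, y, ht, U, hU, rfl⟩)

lemma isClosed_stronglyReachableSet :
    IsClosed[strongTopology E] (stronglyReachableSet H₀ Hc) :=
  @isClosed_closure _ (strongTopology E) _

/-- Recurrence: the group of a drift with an eigenbasis can be reached for all times. -/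
lemma mem_stronglyReachableSet_of_diagonal {ι : Type*} (b : HilbertBasis ι ℂ E) {ev : ι → ℝ}
    {U₀ : ℝ → unitary (E →L[ℂ] E)} (hU₀ : IsUnitaryGroupOf H₀ U₀)
    (hb : ∀ t i, (U₀ t : E →L[ℂ] E) (b i) = (Circle.exp (t * ev i) : ℂ) • b i) (t : ℝ) :
    U₀ t ∈ stronglyReachableSet H₀ Hc := by
  -- The return step |t| + 1 makes n(|t| + 1) + t positive for every n ≥ 1.
  obtain ⟨l, hl, hle, hrec⟩ := exists_recurrence b hb (|t| + 1)
  refine mem_of_isClosed_strong_of_tendsto isClosed_stronglyReachableSet (l := l)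
    (G := fun n : ℕ => U₀ (n * (|t| + 1) + t)) (fun x => ?_) ?_
  · simp only [hU₀.add_apply]
    exact hrec _
  · filter_upwards [hle (eventually_ge_atTop 1)] with n hn
    refine mem_stronglyReachableSet_of_isUnitaryGroupOf (y := 0)
      (by rw [hamiltonian_zero]; exact hU₀) ?_
    have h1 : (1 : ℝ) ≤ n := by exact_mod_cast hn
    have h2 := neg_abs_le t
    nlinarith [abs_nonneg t]

/-- If the drift group is reachable for all times, then so are the groups of the controls. -/
lemma mem_stronglyReachableSet_of_control {U₀ : ℝ → unitary (E →L[ℂ] E)}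
    (hU₀ : IsUnitaryGroupOf H₀ U₀) (hdom : Dense (H₀.domain : Set E))
    (hreach : ∀ t, U₀ t ∈ stronglyReachableSet H₀ Hc) {j : Fin N} (hj : IsSelfAdjoint (Hc j))
    {t : ℝ} {V : unitary (E →L[ℂ] E)} (hV : IsExp (ofBounded (Hc j)) t V) :
    V ∈ stronglyReachableSet H₀ Hc := by
  obtain ⟨W, hW, rfl⟩ := hV
  obtain ⟨Y, hY⟩ := hU₀.exists_perturbed (isSelfAdjoint_ofReal_smul hj t)
  -- The time t is absorbed into the amplitude and the formula used at time 1, so the perturbed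
  -- evolution runs for the positive time 1/n whatever the sign of t.
  have hlim := hU₀.tendsto_interaction_pow hY (hW.smul t) hdom 1
  rw [mul_one] at hlim
  refine mem_of_isClosed_strong_of_tendsto isClosed_stronglyReachableSet hlim ?_
  let R : Submonoid (unitary (E →L[ℂ] E)) :=
    { carrier := stronglyReachableSet H₀ Hc
      mul_mem' := mul_mem_strong_closure _
      one_mem' := hU₀.map_zero ▸ hreach 0 }
  filter_upwards [eventually_gt_atTop 0] with n hn
  have hn' : (0 : ℝ) < 1 / n := by positivity
  exact R.pow_mem (R.mul_mem (hreach _) (mem_stronglyReachableSet_of_isUnitaryGroupOf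
    (y := Pi.single j t) (by rw [hamiltonian_single]; exact hY) hn')) n

end Reachability

end QuantumControl

/-! ### The two inclusions. -/

theorem mainTheorem8 {E : Type*} [NormedAddCommGroup E] [InnerProductSpace ℂ E]
    [CompleteSpace E] [TopologicalSpace.SeparableSpace E] {N : ℕ}
    (H₀ : E →ₗ.[ℂ] E) (hH₀ : IsSelfAdjoint H₀)
    (hpp : QuantumControl.HasPurePointSpectrum H₀)
    (Hc : Fin N → E →L[ℂ] E) (hHc : ∀ j, IsSelfAdjoint (Hc j)) :
    QuantumControl.stronglyReachableSet H₀ Hc =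
      (QuantumControl.restrictedDynamicalGroup H₀ Hc : Set (unitary (E →L[ℂ] E))) := by
  open QuantumControl in
  obtain ⟨ι, b, ev, hev⟩ := exists_hilbertBasis_eigenvectors hH₀ hpp
  obtain ⟨U₀, hU₀, hdiag⟩ := exists_isUnitaryGroupOf_diagonal hH₀ b hev
  have hdom := hH₀.dense_domain
  have hreach : ∀ t, U₀ t ∈ stronglyReachableSet H₀ Hc :=
    mem_stronglyReachableSet_of_diagonal b hU₀ hdiag
  refine Set.Subset.antisymm ?_ ?_
  · rw [restrictedDynamicalGroup, Subgroup.coe_sInf]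
    refine Set.subset_iInter₂ fun K hK => ?_
    refine @closure_minimal _ (strongTopology E) _ _ ?_ hK.1
    refine (Subsemigroup.closure_le (S := K.toSubmonoid.toSubsemigroup)).mpr ?_
    rintro V ⟨τ, y, -, hV⟩
    exact mem_of_isExp_hamiltonian hU₀ hdom hHc hK.1 hK.2.1 hK.2.2 hV
  -- The closure is a priori only a semigroup; its elements with reachable inverse form a group,
  -- strongly closed because inversion is strongly continuous.
  · let R : Subgroup (unitary (E →L[ℂ] E)) :=
      { carrier := {V | V ∈ stronglyReachableSet H₀ Hc ∧ V⁻¹ ∈ stronglyReachableSet H₀ Hc}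
        mul_mem' := fun hV hW => ⟨mul_mem_strong_closure _ hV.1 hW.1, by
          rw [mul_inv_rev]
          exact mul_mem_strong_closure _ hW.2 hV.2⟩
        one_mem' := by
          have h := hreach 0
          rw [hU₀.map_zero] at h
          exact ⟨h, by rwa [inv_one]⟩
        inv_mem' := fun hV => ⟨hV.2, by rw [inv_inv]; exact hV.1⟩ }
    have hR : restrictedDynamicalGroup H₀ Hc ≤ R := by
      refine sInf_le ⟨?_, ?_, ?_⟩
      · exact @IsClosed.inter _ _ _ (strongTopology E) isClosed_stronglyReachableSet
          (@IsClosed.preimage _ _ (strongTopology E) (strongTopology E) _ continuous_strong_inv _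
            isClosed_stronglyReachableSet)
      · rintro t V ⟨U, hU, rfl⟩
        rw [hU.unique hU₀ hdom]
        exact ⟨hreach t, hU₀.map_neg t ▸ hreach (-t)⟩
      · rintro j t V ⟨W, hW, rfl⟩
        exact ⟨mem_stronglyReachableSet_of_control hU₀ hdom hreach (hHc j) ⟨W, hW, rfl⟩,
          mem_stronglyReachableSet_of_control hU₀ hdom hreach (hHc j)
            ⟨W, hW, (hW.map_neg t).symm⟩⟩
    exact fun V hV => (hR hV).1
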